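/- **Theorem.** Let $n\ge 1$, write $[n]=\{0,\dots,n-1\}$, and let $\gamma_0<\gamma_1<\dots<\gamma_{n-1}$ be real numbers. Consider the binary-instrument case. Let $M$ be the $0/1$ matrix with rows indexed by $(i,j,d_0,d_1)\in[n]^2\times\{0,1\}^2$ and columns indexed by $(y,d,z)\in[n]\times\{0,1\}^2$, whose entry in row $(i,j,d_0,d_1)$ and column $(y,d,z)$ is $1$ if either $d=d_z=0$ and $y=i$, or $d=d_z=1$ and $y=j$, and is $0$ otherwise. Let $c_{(i,j,d_0,d_1)}=\gamma_j-\gamma_i$ and $\mathcal H=\{v\in\mathbb R^{n\times2\times2}: Mv\le c\}$. Call $v,w$ *$M$-equivalent* if $Mv=Mw$, and *$M$-distinct* otherwise. A point $v\in\mathcal H$ is a *vertex* of $\mathcal H$ if, whenever $v=\lambda v_1+(1-\lambda)v_2$ with $\lambda\in(0,1)$ and $v_1,v_2\in\mathcal H$, the vectors $v,v_1,v_2$ are $M$-equivalent. Let $S=S_1\cup S_2\cup S_3\subseteq\{0,1\}^{n\times2\times2}$, where: * $B\in S_1$ iff there is $t\in\{0,\dots,n-2\}$ with $B_{i00}=B_{i01}=1$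 for all $i\ge t$ and $B_{i00}\ne B_{i01}$ for all $i<t$; $B_{i10}\neq B_{i11}$ for all $i\in[n]$; and there exist $i,j\in[n]$ with $B_{i10}=B_{j11}=1$. * $B\in S_2$ iff $B_{(n-1)00}=B_{(n-1)01}=B_{010}=B_{011}=1$; $B_{i00}\ne B_{i01}$ for all $i<n-1$; and $B_{j10}\neq B_{j11}$ for all $j>0$. * $B\in S_3$ iff there is $s\in\{1,\dots,n-1\}$ with $B_{i10}=B_{i11}=1$ for all $i\le s$ and $B_{i10}\neq B_{i11}$ for all $i>s$; $B_{i00}\ne B_{i01}$ for all $i\in[n]$; and there exist $i,j\in[n]$ with $B_{i00}=B_{j01}=1$. (The three sets are disjoint, and $t$, $s$ are determined by $B$.) For $B\in S$ put $\alpha=-\gamma_0-\gamma_t$ if $B\in S_1$, $\alpha=-\gamma_0-\gamma_{n-1}$ if $B\in S_2$, and $\alpha=-\gamma_s-\gamma_{n-1}$ if $B\in S_3$. Define $u(B)\in\mathbb R^{n\times2\times2}$ by $$u_{i00}=\begin{cases}-\gamma_i-\alpha& B_{i00}=1\\ \gamma_0& B_{i00}=0\end{cases},\quad u_{i10}=\begin{cases}\gamma_i&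 B_{i10}=1\\ -\gamma_{n-1}-\alpha& B_{i10}=0\end{cases},\quad u_{i01}=\begin{cases}-\gamma_i& B_{i01}=1\\ \gamma_0+\alpha& B_{i01}=0\end{cases},\quad u_{i11}=\begin{cases}\gamma_i+\alpha& B_{i11}=1\\ -\gamma_{n-1}& B_{i11}=0\end{cases}.$$ Then $\mathcal V=\{u(B):B\in S\}$ is a set of pairwise $M$-distinct vertices of $\mathcal H$, and every vertex of $\mathcal H$ is $M$-equivalent to a member of $\mathcal V$. Moreover $B\mapsto[u(B)]$ is a bijection from $S$ onto the set of $M$-equivalence classes of vertices of $\mathcal H$, and the number of these classes, which is also $|S|$, is exactly $5\cdot4^{n-1}-2^{n+2}+4$. -/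

import Mathlib

namespace BinaryIV

/-- Index `(i, j, 𝐝)` of the full-data probability
`q_{ij,𝐝} = Q(Y⁽⁰⁾ = γ_i, Y⁽¹⁾ = γ_j, (D⁽⁰⁾,…,D⁽ˡ⁻¹⁾) = 𝐝)`. -/
abbrev Row (n l : ℕ) : Type := Fin n × Fin n × (Fin l → Fin 2)

/-- Index `(y, d, z)` of the observed probability `p_{yd,z} = P(Y = γ_y, D = d | Z = z)`. -/
abbrev Col (n l : ℕ) : Type := Fin n × Fin 2 × Fin l

/-- The variable `q_{ij,𝐝}` appears in the equation of `p_{yd,z}`, these equations being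
`p_{y0,z} = ∑_j ∑_{𝐝 : 𝐝_z = 0} q_{yj,𝐝}` and `p_{y1,z} = ∑_i ∑_{𝐝 : 𝐝_z = 1} q_{iy,𝐝}`. -/
def Appears {n l : ℕ} (r : Row n l) (k : Col n l) : Prop :=
  (k.2.1 = 0 ∧ r.2.2 k.2.2 = 0 ∧ r.1 = k.1) ∨ (k.2.1 = 1 ∧ r.2.2 k.2.2 = 1 ∧ r.2.1 = k.1)

instance {n l : ℕ} (r : Row n l) (k : Col n l) : Decidable (Appears r k) := by
  unfold Appears; infer_instance

/-- The binary constraint matrix `M`. -/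
def M (n l : ℕ) : Matrix (Row n l) (Col n l) ℝ :=
  Matrix.of fun r k => if Appears r k then 1 else 0

/-- The cost vector of the average treatment effect, `c_{ij,𝐝} = γ_j - γ_i`. -/
def cost {n : ℕ} (l : ℕ) (γ : Fin n → ℝ) : Row n l → ℝ := fun r => γ r.2.1 - γ r.1

/-- The dual polyhedron `H = {v : M v ≤ c}`. -/
def H {n : ℕ} (l : ℕ) (γ : Fin n → ℝ) : Set (Col n l → ℝ) :=
  {v | (M n l).mulVec v ≤ cost l γ}

/-- `M`-equivalence of vectors. Two vectors are `M`-distinct if this fails. -/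
def MEquiv {n l : ℕ} (v w : Col n l → ℝ) : Prop := (M n l).mulVec v = (M n l).mulVec w

/-- Vertices of `H`, in the sense of extremality modulo `ker M`. -/
def IsVertex {n l : ℕ} (γ : Fin n → ℝ) (v : Col n l → ℝ) : Prop :=
  v ∈ H l γ ∧ ∀ v₁ ∈ H l γ, ∀ v₂ ∈ H l γ, ∀ a : ℝ, 0 < a → a < 1 →
    v = a • v₁ + (1 - a) • v₂ → MEquiv v v₁ ∧ MEquiv v v₂

/-- `M`-equivalence restricted to the vertices of `H`. -/
def vertexSetoid {n : ℕ} (l : ℕ) (γ : Fin n → ℝ) : Setoid {v : Col n l → ℝ // IsVertex γ v} where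
  r v w := MEquiv v.1 w.1
  iseqv := ⟨fun _ => rfl, fun h => Eq.symm h, fun h h' => Eq.trans h h'⟩

/-- The `M`-equivalence classes of vertices of `H`. -/
abbrev VertexClass {n : ℕ} (l : ℕ) (γ : Fin n → ℝ) : Type := Quotient (vertexSetoid l γ)

/-- The index `n - 1`. -/
def lastIdx (n : ℕ) [NeZero n] : Fin n := ⟨n - 1, Nat.sub_lt (NeZero.pos n) Nat.one_pos⟩

/-- Binary vectors indexed by `(y, d, z)`, for a binary instrument; `true` stands for `1`. -/
abbrev Signature (n : ℕ) : Type := Col n 2 → Bool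

/-- Membership in `S₁` with the index `t ∈ {0, …, n - 2}`. -/
def IsS1At {n : ℕ} [NeZero n] (t : Fin n) (B : Signature n) : Prop :=
  t < lastIdx n ∧
  (∀ i, t ≤ i → B (i, 0, 0) = true ∧ B (i, 0, 1) = true) ∧
  (∀ i, i < t → B (i, 0, 0) ≠ B (i, 0, 1)) ∧
  (∀ i, B (i, 1, 0) ≠ B (i, 1, 1)) ∧
  (∃ i j, B (i, 1, 0) = true ∧ B (j, 1, 1) = true)

/-- Membership in `S₃`; here `s ∈ {1, …, n - 1}` is the largest index with
`B_{s10} = B_{s11} = 1`. -/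
def IsS3At {n : ℕ} [NeZero n] (s : Fin n) (B : Signature n) : Prop :=
  0 < s ∧
  (∀ i, i ≤ s → B (i, 1, 0) = true ∧ B (i, 1, 1) = true) ∧
  (∀ i, s < i → B (i, 1, 0) ≠ B (i, 1, 1)) ∧
  (∀ i, B (i, 0, 0) ≠ B (i, 0, 1)) ∧
  (∃ i j, B (i, 0, 0) = true ∧ B (j, 0, 1) = true)

def S1 (n : ℕ) [NeZero n] : Set (Signature n) := {B | ∃ t, IsS1At t B}

def S2 (n : ℕ) [NeZero n] : Set (Signature n) :=
  {B | (B (lastIdx n, 0, 0) = true ∧ B (lastIdx n, 0, 1) = true ∧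
      B (0, 1, 0) = true ∧ B (0, 1, 1) = true) ∧
    (∀ i, i < lastIdx n → B (i, 0, 0) ≠ B (i, 0, 1)) ∧
    (∀ j, 0 < j → B (j, 1, 0) ≠ B (j, 1, 1))}

def S3 (n : ℕ) [NeZero n] : Set (Signature n) := {B | ∃ s, IsS3At s B}

/-- The admissible signatures. -/
def S (n : ℕ) [NeZero n] : Set (Signature n) := S1 n ∪ S2 n ∪ S3 n

open Classical in
/-- The number `α`: it is `-γ_0 - γ_t` on `S₁`, `-γ_0 - γ_{n-1}` on `S₂` and `-γ_s - γ_{n-1}` on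
`S₃`; see the three lemmas below. -/
noncomputable def alpha {n : ℕ} [NeZero n] (γ : Fin n → ℝ) (B : Signature n) : ℝ :=
  if h : ∃ t, IsS1At t B then -γ 0 - γ h.choose
  else if h : ∃ s, IsS3At s B then -γ h.choose - γ (lastIdx n)
  else -γ 0 - γ (lastIdx n)

/-- The vertex map `B ↦ u(B)`. -/
noncomputable def u {n : ℕ} [NeZero n] (γ : Fin n → ℝ) (B : Signature n) : Col n 2 → ℝ
  | (i, 0, 0) => if B (i, 0, 0) = true then -γ i - alpha γ B else γ 0
  | (i, 1, 0) => if B (i, 1, 0) = true then γ i else -γ (lastIdx n) - alpha γ B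
  | (i, 0, 1) => if B (i, 0, 1) = true then -γ i else γ 0 + alpha γ B
  | (i, 1, 1) => if B (i, 1, 1) = true then γ i + alpha γ B else -γ (lastIdx n)

theorem IsS1At.unique {n : ℕ} [NeZero n] {t t' : Fin n} {B : Signature n}
    (h : IsS1At t B) (h' : IsS1At t' B) : t = t' := by
  obtain ⟨-, h1, h2, -⟩ := h
  obtain ⟨-, h1', h2', -⟩ := h'
  rcases lt_trichotomy t t' with hlt | heq | hlt
  · exact absurd ((h1 t le_rfl).1.trans (h1 t le_rfl).2.symm) (h2' t hlt)
  · exact heq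
  · exact absurd ((h1' t' le_rfl).1.trans (h1' t' le_rfl).2.symm) (h2 t' hlt)

theorem IsS3At.unique {n : ℕ} [NeZero n] {s s' : Fin n} {B : Signature n}
    (h : IsS3At s B) (h' : IsS3At s' B) : s = s' := by
  obtain ⟨-, h1, h2, -⟩ := h
  obtain ⟨-, h1', h2', -⟩ := h'
  rcases lt_trichotomy s s' with hlt | heq | hlt
  · exact absurd ((h1' s' le_rfl).1.trans (h1' s' le_rfl).2.symm) (h2 s' hlt)
  · exact heq
  · exact absurd ((h1 s le_rfl).1.trans (h1 s le_rfl).2.symm) (h2' s hlt)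

theorem alpha_of_isS1At {n : ℕ} [NeZero n] (γ : Fin n → ℝ) {t : Fin n} {B : Signature n}
    (h : IsS1At t B) : alpha γ B = -γ 0 - γ t := by
  have hex : ∃ t, IsS1At t B := ⟨t, h⟩
  rw [alpha, dif_pos hex, hex.choose_spec.unique h]

theorem alpha_of_mem_S2 {n : ℕ} [NeZero n] (γ : Fin n → ℝ) {B : Signature n}
    (h : B ∈ S2 n) : alpha γ B = -γ 0 - γ (lastIdx n) := by
  obtain ⟨⟨h1, h2, h3, h4⟩, -⟩ := h
  have n1 : ¬ ∃ t, IsS1At t B := fun ⟨_, _, _, _, hd, _⟩ => hd 0 (h3.trans h4.symm)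
  have n3 : ¬ ∃ s, IsS3At s B := fun ⟨_, _, _, _, hd, _⟩ => hd (lastIdx n) (h1.trans h2.symm)
  rw [alpha, dif_neg n1, dif_neg n3]

theorem alpha_of_isS3At {n : ℕ} [NeZero n] (γ : Fin n → ℝ) {s : Fin n} {B : Signature n}
    (h : IsS3At s B) : alpha γ B = -γ s - γ (lastIdx n) := by
  have hex : ∃ s, IsS3At s B := ⟨s, h⟩
  have n1 : ¬ ∃ t, IsS1At t B := fun ⟨_, _, _, _, hd, _⟩ =>
    hd s ((h.2.1 s le_rfl).1.trans (h.2.1 s le_rfl).2.symm)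
  rw [alpha, dif_neg n1, dif_pos hex, hex.choose_spec.unique h]

end BinaryIV

namespace BinaryIV

/-! Each row of `M` adds one entry with `z = 0` to one with `z = 1`. Put `A i = v_{i00} + γ i`, `B i
= v_{i01} + γ i`, `P j = v_{j10} - γ j`, `Q j = v_{j11} - γ j`. The polyhedron becomes `A i + B i ≤
f i`, `P j + Q j ≤ g j`, `A i + Q j ≤ 0`, `B i + P j ≤ 0`, with `f i = γ 0 + γ i` and `g j = -γ j -
γ (n-1)`. The kernel of `M` is the line on which `A`, `P` rise by a constant and `B`, `Q` fall by
it.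

A vertex is a feasible point whose tight rows leave only kernel directions (`isVertex_iff_isRigid`).
At such a point the maxima of `A, B, P, Q` are `x, y, -y, -x`; an entry below its maximum is fixed
by a tight row with a maximal partner; and some row is tight between two maximal entries, since
otherwise `x` could move with `y` fixed (`IsRigid.exists_hasPeaks`). Hence the class depends only on
the pattern of maximal entries and on `β = x + y`, and conversely every admissible pair gives a
rigid point (`Admissible.isRigid`).

Both entries of a row are maximal exactly where `β ≤ f i`, respectively `-β ≤ g j`. As `f`
increases, `g` decreases and `max f = -max g = γ 0 + γ (n-1)`, comparing `β` with this number gives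
`S₁`, `S₂`, `S₃` and determines `α = -β`. The pattern of maxima is invariant under `M`-equivalence,
so it inverts `u`. The count is `2(2^(n-1) - 1)(2^n - 2) + 4^(n-1)`. -/

/-! ### Rows of `M` as sums of two entries -/

theorem mulVec_apply {n : ℕ} (v : Col n 2 → ℝ) (r : Row n 2) :
    (M n 2).mulVec v r =
      (if r.2.2 0 = 0 then v (r.1, 0, 0) else v (r.2.1, 1, 0)) +
      (if r.2.2 1 = 0 then v (r.1, 0, 1) else v (r.2.1, 1, 1)) := by
  obtain ⟨i, j, d⟩ := r
  have key : ∀ x : Fin 2, x = 0 ∨ x = 1 := by decide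
  rcases key (d 0) with h0 | h0 <;> rcases key (d 1) with h1 | h1 <;>
    simp [M, Matrix.mulVec, dotProduct, Appears, Fintype.sum_prod_type, Fin.sum_univ_two, h0, h1,
      Finset.sum_add_distrib]

/-- A statement about all rows splits into the four treatment patterns. -/
theorem forall_row_iff {n : ℕ} (v : Col n 2 → ℝ) (p : Fin n → Fin n → ℝ → Prop) :
    (∀ r : Row n 2, p r.1 r.2.1 ((M n 2).mulVec v r)) ↔
      (∀ i j, p i j (v (i, 0, 0) + v (i, 0, 1))) ∧ (∀ i j, p i j (v (j, 1, 0) + v (j, 1, 1))) ∧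
      (∀ i j, p i j (v (i, 0, 0) + v (j, 1, 1))) ∧ (∀ i j, p i j (v (j, 1, 0) + v (i, 0, 1))) := by
  constructor
  · intro h
    refine ⟨fun i j => ?_, fun i j => ?_, fun i j => ?_, fun i j => ?_⟩
    · simpa [mulVec_apply] using h (i, j, ![0, 0])
    · simpa [mulVec_apply] using h (i, j, ![1, 1])
    · simpa [mulVec_apply] using h (i, j, ![0, 1])
    · simpa [mulVec_apply] using h (i, j, ![1, 0])
  · rintro ⟨h1, h2, h3, h4⟩ ⟨i, j, d⟩
    rw [mulVec_apply]
    dsimp only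
    split_ifs
    exacts [h1 i j, h3 i j, h4 i j, h2 i j]

theorem mem_H_iff {n : ℕ} {γ : Fin n → ℝ} {v : Col n 2 → ℝ} :
    v ∈ H 2 γ ↔
      (∀ i j, v (i, 0, 0) + v (i, 0, 1) ≤ γ j - γ i) ∧
      (∀ i j, v (j, 1, 0) + v (j, 1, 1) ≤ γ j - γ i) ∧
      (∀ i j, v (i, 0, 0) + v (j, 1, 1) ≤ γ j - γ i) ∧
      (∀ i j, v (j, 1, 0) + v (i, 0, 1) ≤ γ j - γ i) :=
  forall_row_iff v fun i j x => x ≤ γ j - γ i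

theorem mulVec_eq_zero_iff {n : ℕ} {w : Col n 2 → ℝ} :
    (M n 2).mulVec w = 0 ↔
      (∀ i, w (i, 0, 0) + w (i, 0, 1) = 0) ∧ (∀ j, w (j, 1, 0) + w (j, 1, 1) = 0) ∧
      (∀ i j, w (i, 0, 0) + w (j, 1, 1) = 0) ∧ (∀ i j, w (j, 1, 0) + w (i, 0, 1) = 0) := by
  rw [funext_iff]
  refine (forall_row_iff w fun _ _ x => x = 0).trans ?_
  exact ⟨fun h => ⟨fun i => h.1 i i, fun i => h.2.1 i i, h.2.2⟩,
    fun h => ⟨fun i _ => h.1 i, fun _ j => h.2.1 j, h.2.2⟩⟩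

theorem mEquiv_iff {n : ℕ} {v w : Col n 2 → ℝ} :
    MEquiv v w ↔
      (∀ i, v (i, 0, 0) + v (i, 0, 1) = w (i, 0, 0) + w (i, 0, 1)) ∧
      (∀ j, v (j, 1, 0) + v (j, 1, 1) = w (j, 1, 0) + w (j, 1, 1)) ∧
      (∀ i j, v (i, 0, 0) + v (j, 1, 1) = w (i, 0, 0) + w (j, 1, 1)) ∧
      (∀ i j, v (j, 1, 0) + v (i, 0, 1) = w (j, 1, 0) + w (i, 0, 1)) := by
  rw [MEquiv, ← sub_eq_zero, ← Matrix.mulVec_sub, mulVec_eq_zero_iff]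
  simp only [Pi.sub_apply]
  refine ⟨fun h => ⟨fun i => ?_, fun i => ?_, fun i j => ?_, fun i j => ?_⟩,
    fun h => ⟨fun i => ?_, fun i => ?_, fun i j => ?_, fun i j => ?_⟩⟩
  · linarith [h.1 i]
  · linarith [h.2.1 i]
  · linarith [h.2.2.1 i j]
  · linarith [h.2.2.2 i j]
  · linarith [h.1 i]
  · linarith [h.2.1 i]
  · linarith [h.2.2.1 i j]
  · linarith [h.2.2.2 i j]

/-! ### Vertices and tight rows -/

/-- A finite family of positive slacks absorbs a small multiple of any family of increments. -/
theorem exists_pos_mul_abs_le {ι : Type*} [Finite ι] (s x : ι → ℝ)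
    (hs : ∀ r, 0 ≤ s r) (hx : ∀ r, s r = 0 → x r = 0) :
    ∃ ε : ℝ, 0 < ε ∧ ∀ r, ε * |x r| ≤ s r := by
  have h : ∀ r, ∀ᶠ ε : ℝ in nhdsWithin 0 (Set.Ioi 0), ε * |x r| ≤ s r := by
    intro r
    rcases (hs r).eq_or_lt with h0 | h0
    · simp [hx r h0.symm, hs r]
    · have : Filter.Tendsto (fun ε : ℝ => ε * |x r|) (nhdsWithin 0 (Set.Ioi 0)) (nhds (0 * |x r|)) :=
        ((continuous_id.mul continuous_const).tendsto 0).mono_left nhdsWithin_le_nhds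
      rw [zero_mul] at this
      exact (this.eventually_lt_const h0).mono fun _ h => h.le
  obtain ⟨ε, h1, h2⟩ := ((Filter.eventually_all.2 h).and self_mem_nhdsWithin).exists
  exact ⟨ε, h2, h1⟩

/-- A feasible point is a vertex iff the directions annihilated by its tight rows are in `ker M`. -/
theorem isVertex_iff_tight {n l : ℕ} {γ : Fin n → ℝ} {v : Col n l → ℝ} :
    IsVertex γ v ↔ v ∈ H l γ ∧ ∀ w : Col n l → ℝ,
      (∀ r, (M n l).mulVec v r = cost l γ r → (M n l).mulVec w r = 0) →
        (M n l).mulVec w = 0 := by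
  constructor
  · rintro ⟨hv, hext⟩
    refine ⟨hv, fun w hw => ?_⟩
    obtain ⟨ε, hε, hle⟩ := exists_pos_mul_abs_le
      (fun r => cost l γ r - (M n l).mulVec v r) ((M n l).mulVec w)
      (fun r => sub_nonneg.2 (hv r)) (fun r hr => hw r (sub_eq_zero.1 hr).symm)
    have h1 : v + ε • w ∈ H l γ := fun r => by
      have h := hle r
      have h' := mul_le_mul_of_nonneg_left (le_abs_self ((M n l).mulVec w r)) hε.le
      simp only [Matrix.mulVec_add, Matrix.mulVec_smul, Pi.add_apply, Pi.smul_apply, smul_eq_mul]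
      linarith
    have h2 : v - ε • w ∈ H l γ := fun r => by
      have h := hle r
      have h' := mul_le_mul_of_nonneg_left (neg_abs_le ((M n l).mulVec w r)) hε.le
      simp only [Matrix.mulVec_sub, Matrix.mulVec_smul, Pi.sub_apply, Pi.smul_apply, smul_eq_mul]
      linarith
    have h3 := (hext _ h1 _ h2 (1 / 2) (by norm_num) (by norm_num)
      (by ext k; simp only [Pi.add_apply, Pi.smul_apply, Pi.sub_apply, smul_eq_mul]; ring)).1
    rw [MEquiv, Matrix.mulVec_add, Matrix.mulVec_smul, left_eq_add] at h3
    exact (smul_eq_zero.1 h3).resolve_left hε.ne'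
  · rintro ⟨hv, hrig⟩
    have key : ∀ v₁ ∈ H l γ, ∀ v₂ ∈ H l γ, ∀ a : ℝ, 0 < a → a < 1 →
        v = a • v₁ + (1 - a) • v₂ → MEquiv v v₁ := by
      intro v₁ h₁ v₂ h₂ a ha ha' hav
      have : (M n l).mulVec (v₁ - v) = 0 := by
        refine hrig _ fun r hr => ?_
        have e := congrFun (congrArg (M n l).mulVec hav) r
        have h1 := h₁ r
        have h2 := h₂ r
        simp only [Matrix.mulVec_add, Matrix.mulVec_smul, Pi.add_apply, Pi.smul_apply,
          smul_eq_mul] at e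
        simp only [Matrix.mulVec_sub, Pi.sub_apply]
        have h3 := mul_le_mul_of_nonneg_left h2 (sub_pos.2 ha').le
        have h4 : a * (M n l).mulVec v₁ r ≥ a * cost l γ r := by
          rw [hr] at e; linarith
        have h5 := le_of_mul_le_mul_left h4 ha
        linarith
      rw [Matrix.mulVec_sub, sub_eq_zero] at this
      exact this.symm
    refine ⟨hv, fun v₁ h₁ v₂ h₂ a ha ha' hav => ⟨key v₁ h₁ v₂ h₂ a ha ha' hav,
      key v₂ h₂ v₁ h₁ (1 - a) (by linarith) (by linarith) ?_⟩⟩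
    rw [hav, sub_sub_cancel, add_comm]

/-! ### The coupled system and its symmetries -/

/-- Feasibility and rigidity for the coupled system
`A i + B i ≤ f i`, `P j + Q j ≤ g j`, `A i + Q j ≤ 0`, `B i + P j ≤ 0`: directions along which
every tight constraint stays tight are trivial. -/
structure IsRigid {n : ℕ} (f g A B P Q : Fin n → ℝ) : Prop where
  ab : ∀ i, A i + B i ≤ f i
  pq : ∀ j, P j + Q j ≤ g j
  aq : ∀ i j, A i + Q j ≤ 0
  bp : ∀ i j, B i + P j ≤ 0
  rigid : ∀ a b p q : Fin n → ℝ, (∀ i, A i + B i = f i → a i + b i = 0) →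
    (∀ j, P j + Q j = g j → p j + q j = 0) → (∀ i j, A i + Q j = 0 → a i + q j = 0) →
    (∀ i j, B i + P j = 0 → b i + p j = 0) →
    (∀ i, a i + b i = 0) ∧ (∀ j, p j + q j = 0) ∧ (∀ i j, a i + q j = 0) ∧
      (∀ i j, b i + p j = 0)

/-- The symmetry exchanging the two instrument values. With `IsRigid.dual`, which exchanges the
treatments as well, it reduces statements about `B`, `P`, `Q` to statements about `A`. -/
theorem IsRigid.swap {n : ℕ} {f g A B P Q : Fin n → ℝ} (h : IsRigid f g A B P Q) :
    IsRigid f g B A Q P where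
  ab i := by linarith [h.ab i]
  pq j := by linarith [h.pq j]
  aq := h.bp
  bp := h.aq
  rigid a b p q h1 h2 h3 h4 := by
    obtain ⟨k1, k2, k3, k4⟩ := h.rigid b a q p (fun i hi => by linarith [h1 i (by linarith)])
      (fun i hi => by linarith [h2 i (by linarith)]) h4 h3
    exact ⟨fun i => by linarith [k1 i], fun i => by linarith [k2 i], k4, k3⟩

theorem IsRigid.dual {n : ℕ} {f g A B P Q : Fin n → ℝ} (h : IsRigid f g A B P Q) :
    IsRigid g f Q P B A where
  ab i := by linarith [h.pq i]
  pq j := by linarith [h.ab j]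
  aq i j := by linarith [h.aq j i]
  bp i j := by linarith [h.bp j i]
  rigid a b p q h1 h2 h3 h4 := by
    obtain ⟨k1, k2, k3, k4⟩ := h.rigid q p b a (fun i hi => by linarith [h2 i (by linarith)])
      (fun i hi => by linarith [h1 i (by linarith)])
      (fun i j hi => by linarith [h3 j i (by linarith)])
      (fun i j hi => by linarith [h4 j i (by linarith)])
    exact ⟨fun i => by linarith [k2 i], fun i => by linarith [k1 i],
      fun i j => by linarith [k3 j i], fun i j => by linarith [k4 j i]⟩

theorem le_lastIdx {n : ℕ} [NeZero n] (i : Fin n) : i ≤ lastIdx n := by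
  have := i.isLt
  simp only [Fin.le_def, lastIdx]
  omega

/-- The shift by `γ` makes the mixed rows homogeneous. In the unmixed rows one index is free, and
only its extreme value binds: `γ 0` gives `f`, `γ (lastIdx n)` gives `g`. -/
theorem isVertex_iff_isRigid {n : ℕ} [NeZero n] {γ : Fin n → ℝ} (hγ : StrictMono γ)
    {v : Col n 2 → ℝ} :
    IsVertex γ v ↔ IsRigid (fun i => γ 0 + γ i) (fun j => -γ j - γ (lastIdx n))
      (fun i => v (i, 0, 0) + γ i) (fun i => v (i, 0, 1) + γ i)
      (fun j => v (j, 1, 0) - γ j) (fun j => v (j, 1, 1) - γ j) := by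
  have h0 : ∀ i, γ 0 ≤ γ i := fun i => hγ.monotone (Fin.zero_le i)
  have hl : ∀ i, γ i ≤ γ (lastIdx n) := fun i => hγ.monotone (le_lastIdx i)
  have tight : ∀ v w : Col n 2 → ℝ,
      (∀ r, (M n 2).mulVec v r = cost 2 γ r → (M n 2).mulVec w r = 0) ↔
      ((∀ i j, v (i, 0, 0) + v (i, 0, 1) = γ j - γ i → w (i, 0, 0) + w (i, 0, 1) = 0) ∧
      (∀ i j, v (j, 1, 0) + v (j, 1, 1) = γ j - γ i → w (j, 1, 0) + w (j, 1, 1) = 0) ∧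
      (∀ i j, v (i, 0, 0) + v (j, 1, 1) = γ j - γ i → w (i, 0, 0) + w (j, 1, 1) = 0) ∧
      (∀ i j, v (j, 1, 0) + v (i, 0, 1) = γ j - γ i → w (j, 1, 0) + w (i, 0, 1) = 0)) := by
    intro v w
    constructor
    · intro h
      refine ⟨fun i j => ?_, fun i j => ?_, fun i j => ?_, fun i j => ?_⟩
      · simpa [mulVec_apply, cost] using h (i, j, ![0, 0])
      · simpa [mulVec_apply, cost] using h (i, j, ![1, 1])
      · simpa [mulVec_apply, cost] using h (i, j, ![0, 1])
      · simpa [mulVec_apply, cost] using h (i, j, ![1, 0])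
    · rintro ⟨h1, h2, h3, h4⟩ ⟨i, j, d⟩
      rw [mulVec_apply, mulVec_apply, cost]
      dsimp only
      split_ifs
      exacts [h1 i j, h3 i j, h4 i j, h2 i j]
  rw [isVertex_iff_tight]
  constructor
  · rintro ⟨hv, hrig⟩
    obtain ⟨v1, v2, v3, v4⟩ := mem_H_iff.1 hv
    refine ⟨fun i => ?_, fun j => ?_, fun i j => ?_, fun i j => ?_, ?_⟩
    · linarith [v1 i 0]
    · linarith [v2 (lastIdx n) j]
    · linarith [v3 i j]
    · linarith [v4 i j]
    · intro a b p q h1 h2 h3 h4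
      let w : Col n 2 → ℝ := fun k => if k.2.1 = 0 then (if k.2.2 = 0 then a k.1 else b k.1)
        else (if k.2.2 = 0 then p k.1 else q k.1)
      have := hrig w ((tight v w).2 ⟨?_, ?_, ?_, ?_⟩)
      · obtain ⟨k1, k2, k3, k4⟩ := mulVec_eq_zero_iff.1 this
        simp only [w] at k1 k2 k3 k4
        exact ⟨k1, k2, k3, fun i j => by rw [add_comm]; exact k4 i j⟩
      · intro i j h
        -- A row tight at some `j` is also tight at the extreme index `0`, so no tight row is lost
        -- by keeping only that one.
        exact h1 i (by linarith [v1 i 0, h0 j])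
      · intro i j h
        exact h2 j (by linarith [v2 (lastIdx n) j, hl i])
      · intro i j h
        exact h3 i j (by linarith)
      · intro i j h
        exact (add_comm _ _).trans (h4 i j (by linarith))
  · rintro ⟨ab, pq, aq, bp, rig⟩
    refine ⟨mem_H_iff.2 ⟨fun i j => ?_, fun i j => ?_, fun i j => ?_, fun i j => ?_⟩, ?_⟩
    · linarith [ab i, h0 j]
    · linarith [pq j, hl i]
    · linarith [aq i j]
    · linarith [bp i j]
    · intro w hw
      obtain ⟨h1, h2, h3, h4⟩ := (tight v w).1 hw
      obtain ⟨k1, k2, k3, k4⟩ := rig (fun i => w (i, 0, 0)) (fun i => w (i, 0, 1))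
        (fun i => w (i, 1, 0)) (fun i => w (i, 1, 1))
        (fun i h => h1 i 0 (by linarith)) (fun i h => h2 (lastIdx n) i (by linarith))
        (fun i j h => h3 i j (by linarith))
        (fun i j h => (add_comm _ _).trans (h4 i j (by linarith)))
      exact mulVec_eq_zero_iff.2 ⟨k1, k2, k3, fun i j => (add_comm _ _).trans (k4 i j)⟩

/-! ### Structure of rigid points -/

/-- If `A i` is in no tight constraint `A i + Q j ≤ 0`, it is tied to a `B i` in a tight
constraint `B i + P j ≤ 0`. -/
theorem IsRigid.eq_of_forall_ne {n : ℕ} {f g A B P Q : Fin n → ℝ} (h : IsRigid f g A B P Q)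
    (i : Fin n) (hlt : ∀ j, A i + Q j ≠ 0) : A i + B i = f i ∧ ∃ j, B i + P j = 0 := by
  classical
  have hs : ∀ k j, A k + Q j = 0 → (Pi.single i 1 : Fin n → ℝ) k + (0 : Fin n → ℝ) j = 0 := by
    intro k j hk
    have : k ≠ i := by rintro rfl; exact hlt j hk
    simp [this]
  constructor
  -- Test direction: move `A i` alone. Only tightness of `A i + B i ≤ f i` can block it.
  · by_contra hne
    have := (h.rigid (Pi.single i 1) 0 0 0 (fun k hk => ?_) (by simp) hs (by simp)).2.2.1 i i
    · simp at this
    · have : k ≠ i := by rintro rfl; exact hne hk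
      simp [this]
  -- Test direction: raise `A i` and lower `B i`. Only a tight row `B i + P j ≤ 0` can block it.
  · by_contra! hne
    have := (h.rigid (Pi.single i 1) (-Pi.single i 1) 0 0 (by simp) (by simp)
      hs (fun k j hk => ?_)).2.2.1 i i
    · simp at this
    · have : k ≠ i := by rintro rfl; exact hne j hk
      simp [this]

/-- The shape of a rigid point: `x`, `y`, `-y`, `-x` are the maxima of `A`, `B`, `P`, `Q`, an
entry that misses its maximum is tied to a partner attaining it, and `x + y` is a threshold. -/
structure HasPeaks {n : ℕ} (f g A B P Q : Fin n → ℝ) (x y : ℝ) : Prop where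
  le_a : ∀ i, A i ≤ x
  le_b : ∀ i, B i ≤ y
  le_p : ∀ j, P j ≤ -y
  le_q : ∀ j, Q j ≤ -x
  ex_a : ∃ i, A i = x
  ex_b : ∃ i, B i = y
  ex_p : ∃ j, P j = -y
  ex_q : ∃ j, Q j = -x
  tied_a : ∀ i, A i = x ∨ (B i = y ∧ A i + B i = f i)
  tied_b : ∀ i, B i = y ∨ (A i = x ∧ A i + B i = f i)
  tied_p : ∀ j, P j = -y ∨ (Q j = -x ∧ P j + Q j = g j)
  tied_q : ∀ j, Q j = -x ∨ (P j = -y ∧ P j + Q j = g j)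
  threshold : (∃ i, A i = x ∧ B i = y ∧ f i = x + y) ∨
    ∃ j, P j = -y ∧ Q j = -x ∧ g j = -(x + y)

/-- If none were tight, all `A i + B i = f i` and `P j + Q j = g j`; then `A i + Q j = f i + g j -
(B i + P j) ≥ 0` for the given pair. -/
theorem IsRigid.exists_aq_eq_zero {n : ℕ} {f g A B P Q : Fin n → ℝ} (h : IsRigid f g A B P Q)
    (hfg : ∃ i j, 0 ≤ f i + g j) : ∃ i j, A i + Q j = 0 := by
  by_contra! hne
  obtain ⟨i, j, hij⟩ := hfg
  have h1 := (h.eq_of_forall_ne i (hne i)).1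
  have h2 := (h.dual.eq_of_forall_ne j fun k => by rw [add_comm]; exact hne k j).1
  exact hne i j (le_antisymm (h.aq i j) (by linarith [h.bp i j]))

theorem IsRigid.exists_hasPeaks {n : ℕ} {f g A B P Q : Fin n → ℝ} (h : IsRigid f g A B P Q)
    (hfg : ∃ i j, 0 ≤ f i + g j) : ∃ x y, HasPeaks f g A B P Q x y := by
  obtain ⟨i₀, j₀, h₀⟩ := h.exists_aq_eq_zero hfg
  obtain ⟨i₁, j₁, h₁⟩ := h.swap.exists_aq_eq_zero hfg
  have le_a : ∀ i, A i ≤ A i₀ := fun i => by linarith [h.aq i j₀]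
  have le_q : ∀ j, Q j ≤ -A i₀ := fun j => by linarith [h.aq i₀ j]
  have le_b : ∀ i, B i ≤ B i₁ := fun i => by linarith [h.bp i j₁]
  have le_p : ∀ j, P j ≤ -B i₁ := fun j => by linarith [h.bp i₁ j]
  have tied_a : ∀ i, A i = A i₀ ∨ (B i = B i₁ ∧ A i + B i = f i) := fun i => by
    refine or_iff_not_imp_left.2 fun hi => ?_
    have hlt := lt_of_le_of_ne (le_a i) hi
    obtain ⟨k1, j, k2⟩ := h.eq_of_forall_ne i fun j => by linarith [le_q j]
    exact ⟨le_antisymm (le_b i) (by linarith [le_p j]), k1⟩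
  have tied_b : ∀ i, B i = B i₁ ∨ (A i = A i₀ ∧ A i + B i = f i) := fun i => by
    refine or_iff_not_imp_left.2 fun hi => ?_
    have hlt := lt_of_le_of_ne (le_b i) hi
    obtain ⟨k1, j, k2⟩ := h.swap.eq_of_forall_ne i fun j => by linarith [le_p j]
    exact ⟨le_antisymm (le_a i) (by linarith [le_q j]), by linarith⟩
  have tied_q : ∀ i, Q i = -A i₀ ∨ (P i = -B i₁ ∧ P i + Q i = g i) := fun i => by
    refine or_iff_not_imp_left.2 fun hi => ?_
    have hlt := lt_of_le_of_ne (le_q i) hi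
    obtain ⟨k1, j, k2⟩ := h.dual.eq_of_forall_ne i fun j => by linarith [le_a j]
    exact ⟨le_antisymm (le_p i) (by linarith [le_b j]), by linarith⟩
  have tied_p : ∀ i, P i = -B i₁ ∨ (Q i = -A i₀ ∧ P i + Q i = g i) := fun i => by
    refine or_iff_not_imp_left.2 fun hi => ?_
    have hlt := lt_of_le_of_ne (le_p i) hi
    obtain ⟨k1, j, k2⟩ := h.swap.dual.eq_of_forall_ne i fun j => by linarith [le_b j]
    exact ⟨le_antisymm (le_q i) (by linarith [le_a j]), by linarith⟩
  refine ⟨A i₀, B i₁, le_a, le_b, le_p, le_q, ⟨i₀, rfl⟩, ⟨i₁, rfl⟩, ⟨j₁, by linarith⟩,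
    ⟨j₀, by linarith⟩, tied_a, tied_b, tied_p, tied_q, ?_⟩
  by_contra! hno
  obtain ⟨hno1, hno2⟩ := hno
  classical
  -- This direction raises `x` with `y` fixed: maximal `A` rise, maximal `Q` fall, and the
  -- non-maximal `B` and `P` compensate for their maximal partners. Without a threshold row it
  -- preserves all tight rows, yet it is not in the kernel.
  have key := h.rigid (fun i => if A i = A i₀ then 1 else 0)
    (fun i => if B i = B i₁ then 0 else -1) (fun j => if P j = -B i₁ then 0 else 1)
    (fun j => if Q j = -A i₀ then -1 else 0) ?_ ?_ ?_ ?_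
  · obtain ⟨k1, -, -, k4⟩ := key
    have e1 := k1 i₀
    have e2 := k4 i₀ j₁
    have e3 : P j₁ = -B i₁ := by linarith
    simp only [if_true, e3] at e1 e2
    linarith
  · intro i hi
    rcases tied_a i with ha | ⟨hb, -⟩
    · have hb : B i ≠ B i₁ := fun hb => hno1 i ha hb (by rw [← ha, ← hb, hi])
      simp [ha, hb]
    · have ha : A i ≠ A i₀ := fun ha => hno1 i ha hb (by rw [← ha, ← hb, hi])
      simp [ha, hb]
  · intro j hj
    rcases tied_p j with ha | ⟨hb, -⟩
    · have hb : Q j ≠ -A i₀ := fun hb => hno2 j ha hb (by linarith)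
      simp [ha, hb]
    · have ha : P j ≠ -B i₁ := fun ha => hno2 j ha hb (by linarith)
      simp [ha, hb]
  · intro i j hij
    have ha : A i = A i₀ := le_antisymm (le_a i) (by linarith [le_q j])
    have hq : Q j = -A i₀ := le_antisymm (le_q j) (by linarith [le_a i])
    simp [ha, hq]
  · intro i j hij
    have ha : B i = B i₁ := le_antisymm (le_b i) (by linarith [le_p j])
    have hq : P j = -B i₁ := le_antisymm (le_p j) (by linarith [le_b i])
    simp [ha, hq]

/-! ### Admissible signatures give rigid points -/

/-- The combinatorial data of a rigid point: which entries are maximal, and the sum `β` of the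
maxima of `A` and `B`. -/
structure Admissible {n : ℕ} (f g : Fin n → ℝ) (B : Signature n) (β : ℝ) : Prop where
  ex_a : ∃ i, B (i, 0, 0) = true
  ex_b : ∃ i, B (i, 0, 1) = true
  ex_p : ∃ j, B (j, 1, 0) = true
  ex_q : ∃ j, B (j, 1, 1) = true
  or_f : ∀ i, B (i, 0, 0) = true ∨ B (i, 0, 1) = true
  or_g : ∀ j, B (j, 1, 0) = true ∨ B (j, 1, 1) = true
  and_f : ∀ i, B (i, 0, 0) = true ∧ B (i, 0, 1) = true ↔ β ≤ f i
  and_g : ∀ j, B (j, 1, 0) = true ∧ B (j, 1, 1) = true ↔ -β ≤ g j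
  threshold : (∃ i, f i = β) ∨ ∃ j, g j = -β

/-- The kernel direction is used to normalise `y = 0`, `x = β`. The tight mixed rows make a
direction constant on the maximal entries of each kind, the threshold row links the two remaining
constants, and non-maximal entries follow their partners. -/
theorem Admissible.isRigid {n : ℕ} {f g : Fin n → ℝ} {B : Signature n} {β : ℝ}
    (h : Admissible f g B β) :
    IsRigid f g (fun i => if B (i, 0, 0) = true then β else f i)
      (fun i => if B (i, 0, 1) = true then 0 else f i - β)
      (fun j => if B (j, 1, 0) = true then 0 else g j + β)
      (fun j => if B (j, 1, 1) = true then -β else g j) := by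
  have hf : ∀ i, ¬ (B (i, 0, 0) = true ∧ B (i, 0, 1) = true) → f i < β := fun i hi =>
    not_le.1 fun hle => hi ((h.and_f i).2 hle)
  have hg : ∀ j, ¬ (B (j, 1, 0) = true ∧ B (j, 1, 1) = true) → g j < -β := fun j hj =>
    not_le.1 fun hle => hj ((h.and_g j).2 hle)
  have la : ∀ i, (if B (i, 0, 0) = true then β else f i) ≤ β := fun i => by
    split_ifs with hi
    · exact le_rfl
    · exact (hf i fun k => hi k.1).le
  have lb : ∀ i, (if B (i, 0, 1) = true then 0 else f i - β) ≤ 0 := fun i => by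
    split_ifs with hi
    · exact le_rfl
    · linarith [hf i fun k => hi k.2]
  have lp : ∀ j, (if B (j, 1, 0) = true then 0 else g j + β) ≤ 0 := fun j => by
    split_ifs with hj
    · exact le_rfl
    · linarith [hg j fun k => hj k.1]
  have lq : ∀ j, (if B (j, 1, 1) = true then -β else g j) ≤ -β := fun j => by
    split_ifs with hj
    · exact le_rfl
    · exact (hg j fun k => hj k.2).le
  refine ⟨fun i => ?_, fun j => ?_, fun i j => by linarith [la i, lq j],
    fun i j => by linarith [lb i, lp j], ?_⟩
  · rcases h.or_f i with hi | hi
    · by_cases hi' : B (i, 0, 1) = true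
      · simpa [hi, hi'] using (h.and_f i).1 ⟨hi, hi'⟩
      · simp [hi, hi']
    · by_cases hi' : B (i, 0, 0) = true
      · simpa [hi, hi'] using (h.and_f i).1 ⟨hi', hi⟩
      · simp [hi, hi']
  · rcases h.or_g j with hi | hi
    · by_cases hi' : B (j, 1, 1) = true
      · simpa [hi, hi'] using (h.and_g j).1 ⟨hi, hi'⟩
      · simp [hi, hi']
    · by_cases hi' : B (j, 1, 0) = true
      · simpa [hi, hi'] using (h.and_g j).1 ⟨hi', hi⟩
      · simp [hi, hi']
  · intro a b p q hab hpq haq hbp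
    obtain ⟨iA, hiA⟩ := h.ex_a
    obtain ⟨iB, hiB⟩ := h.ex_b
    obtain ⟨jP, hjP⟩ := h.ex_p
    obtain ⟨jQ, hjQ⟩ := h.ex_q
    have haq' : ∀ i j, B (i, 0, 0) = true → B (j, 1, 1) = true → a i + q j = 0 :=
      fun i j hi hj => haq i j (by simp [hi, hj])
    have hbp' : ∀ i j, B (i, 0, 1) = true → B (j, 1, 0) = true → b i + p j = 0 :=
      fun i j hi hj => hbp i j (by simp [hi, hj])
    have ha : ∀ i, B (i, 0, 0) = true → a i = a iA := fun i hi => by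
      linarith [haq' i jQ hi hjQ, haq' iA jQ hiA hjQ]
    have hq : ∀ j, B (j, 1, 1) = true → q j = -a iA := fun j hj => by
      linarith [haq' iA j hiA hj]
    have hb : ∀ i, B (i, 0, 1) = true → b i = b iB := fun i hi => by
      linarith [hbp' i jP hi hjP, hbp' iB jP hiB hjP]
    have hp : ∀ j, B (j, 1, 0) = true → p j = -b iB := fun j hj => by
      linarith [hbp' iB j hiB hj]
    have hsum : b iB = -a iA := by
      rcases h.threshold with ⟨i, hi⟩ | ⟨j, hj⟩
      · obtain ⟨h1, h2⟩ := (h.and_f i).2 hi.ge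
        have := hab i (by simp [h1, h2, hi])
        linarith [ha i h1, hb i h2]
      · obtain ⟨h1, h2⟩ := (h.and_g j).2 hj.ge
        have := hpq j (by simp [h1, h2, hj])
        linarith [hp j h1, hq j h2]
    have ha' : ∀ i, a i = a iA := fun i => by
      by_cases hi : B (i, 0, 0) = true
      · exact ha i hi
      · have hi' := (h.or_f i).resolve_left hi
        linarith [hab i (by simp [hi, hi']), hb i hi']
    have hb' : ∀ i, b i = -a iA := fun i => by
      by_cases hi : B (i, 0, 1) = true
      · exact (hb i hi).trans hsum
      · have hi' := (h.or_f i).resolve_right hi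
        linarith [hab i (by simp [hi, hi']), ha i hi']
    have hp' : ∀ j, p j = a iA := fun j => by
      by_cases hj : B (j, 1, 0) = true
      · linarith [hp j hj]
      · have hj' := (h.or_g j).resolve_left hj
        linarith [hpq j (by simp [hj, hj']), hq j hj']
    have hq' : ∀ j, q j = -a iA := fun j => by
      by_cases hj : B (j, 1, 1) = true
      · exact hq j hj
      · have hj' := (h.or_g j).resolve_right hj
        linarith [hpq j (by simp [hj, hj']), hp j hj']
    exact ⟨fun i => by rw [ha', hb']; ring, fun i => by rw [hp', hq']; ring,
      fun i j => by rw [ha', hq']; ring, fun i j => by rw [hb', hp']; ring⟩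

/-! ### Counting the signatures -/

/-- A signature as its pair of columns `d = 0` and `d = 1`. -/
def signatureEquiv (n : ℕ) :
    Signature n ≃ (Fin n → Bool × Bool) × (Fin n → Bool × Bool) where
  toFun B := (fun i => (B (i, 0, 0), B (i, 0, 1)), fun i => (B (i, 1, 0), B (i, 1, 1)))
  invFun c k := if k.2.1 = 0 then (if k.2.2 = 0 then (c.1 k.1).1 else (c.1 k.1).2)
    else (if k.2.2 = 0 then (c.2 k.1).1 else (c.2 k.1).2)
  left_inv B := by
    ext ⟨i, d, z⟩
    fin_cases d <;> fin_cases z <;> rfl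
  right_inv c := rfl

/-- Columns equal to `(1, 1)` exactly on the set where `p` holds. -/
def columnsOn {n : ℕ} (p : Fin n → Prop) [DecidablePred p] : Finset (Fin n → Bool × Bool) :=
  Fintype.piFinset fun i => if p i then {(true, true)} else {(true, false), (false, true)}

theorem mem_columnsOn {n : ℕ} {p : Fin n → Prop} [DecidablePred p] {c : Fin n → Bool × Bool} :
    c ∈ columnsOn p ↔ ∀ i, (p i → (c i).1 = true ∧ (c i).2 = true) ∧
      (¬ p i → (c i).1 ≠ (c i).2) := by
  simp only [columnsOn, Fintype.mem_piFinset]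
  refine forall_congr' fun i => ?_
  rcases c i with ⟨a, b⟩
  by_cases h : p i <;> cases a <;> cases b <;> simp [h]

theorem card_columnsOn {n : ℕ} (p : Fin n → Prop) [DecidablePred p] :
    (columnsOn p).card = 2 ^ (Finset.univ.filter fun i => ¬ p i).card := by
  rw [columnsOn, Fintype.card_piFinset, Finset.card_filter, ← Finset.prod_pow_eq_pow_sum]
  refine Finset.prod_congr rfl fun i _ => ?_
  by_cases h : p i <;> simp [h]

/-- Columns with exactly one `1` in each row, and a `1` in each of the two positions. -/
def mixedColumns (n : ℕ) : Finset (Fin n → Bool × Bool) :=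
  (columnsOn fun _ : Fin n => False) \ {fun _ => (true, false), fun _ => (false, true)}

theorem mem_mixedColumns {n : ℕ} {c : Fin n → Bool × Bool} :
    c ∈ mixedColumns n ↔ (∀ i, (c i).1 ≠ (c i).2) ∧
      ∃ i j, (c i).1 = true ∧ (c j).2 = true := by
  rw [mixedColumns, Finset.mem_sdiff, mem_columnsOn]
  simp only [false_imp_iff, not_false_eq_true, true_imp_iff, true_and]
  refine and_congr_right fun h => ?_
  have e1 : c = (fun _ => (true, false)) ↔ ∀ j, (c j).2 ≠ true := by
    rw [funext_iff]
    refine forall_congr' fun i => ?_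
    have := h i
    revert this
    rcases c i with ⟨a, b⟩
    cases a <;> cases b <;> simp
  have e2 : c = (fun _ => (false, true)) ↔ ∀ j, (c j).1 ≠ true := by
    rw [funext_iff]
    refine forall_congr' fun i => ?_
    have := h i
    revert this
    rcases c i with ⟨a, b⟩
    cases a <;> cases b <;> simp
  rw [Finset.mem_insert, Finset.mem_singleton, e1, e2]
  push Not
  simp only [exists_and_left, exists_and_right]
  exact and_comm

theorem card_mixedColumns {n : ℕ} [NeZero n] : (mixedColumns n).card = 2 ^ n - 2 := by
  rw [mixedColumns, Finset.card_sdiff_of_subset, card_columnsOn, Finset.card_pair]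
  · simp
  · intro h
    simpa using congrFun h 0
  · intro c hc
    rw [Finset.mem_insert, Finset.mem_singleton] at hc
    rw [mem_columnsOn]
    rcases hc with rfl | rfl <;> simp

/-- In each of `S₁`, `S₂`, `S₃` the conditions on `d = 0` and on `d = 1` are independent, so each
set is a product and cardinalities multiply. -/
theorem S_eq_preimage (n : ℕ) [NeZero n] :
    S n = signatureEquiv n ⁻¹' (
      (((Finset.univ.filter (· < lastIdx n)).biUnion fun t => columnsOn (t ≤ ·)) ×ˢ
        mixedColumns n) ∪
      (columnsOn (lastIdx n ≤ ·) ×ˢ columnsOn (· ≤ (0 : Fin n))) ∪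
      (mixedColumns n ×ˢ
        ((Finset.univ.filter (0 < ·)).biUnion fun s => columnsOn (· ≤ s))) :
      Finset ((Fin n → Bool × Bool) × (Fin n → Bool × Bool))) := by
  have hl : ∀ i : Fin n, lastIdx n ≤ i ↔ i = lastIdx n := fun i => by
    have := i.isLt
    simp only [Fin.le_def, Fin.ext_iff, lastIdx]
    omega
  ext B
  simp only [S, Set.mem_union, Set.mem_preimage, Finset.mem_coe, Finset.mem_union,
    Finset.mem_product, Finset.mem_biUnion, Finset.mem_filter, Finset.mem_univ, true_and,
    mem_columnsOn, mem_mixedColumns, not_le, signatureEquiv]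
  refine or_congr (or_congr ?_ ?_) ?_
  · constructor
    · rintro ⟨t, a, b, c, d, e⟩
      exact ⟨⟨t, a, fun i => ⟨b i, c i⟩⟩, d, e⟩
    · rintro ⟨⟨t, a, b⟩, d, e⟩
      exact ⟨t, a, fun i => (b i).1, fun i => (b i).2, d, e⟩
  · constructor
    · rintro ⟨⟨a, b, c, d⟩, e, f⟩
      refine ⟨fun i => ⟨fun h => ?_, e i⟩, fun i => ⟨fun h => ?_, f i⟩⟩
      · rw [(hl i).1 h]
        exact ⟨a, b⟩
      · rw [nonpos_iff_eq_zero.1 h]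
        exact ⟨c, d⟩
    · rintro ⟨a, b⟩
      exact ⟨⟨((a _).1 le_rfl).1, ((a _).1 le_rfl).2, ((b _).1 le_rfl).1, ((b _).1 le_rfl).2⟩,
        fun i => (a i).2, fun i => (b i).2⟩
  · constructor
    · rintro ⟨t, a, b, c, d, e⟩
      exact ⟨⟨d, e⟩, t, a, fun i => ⟨b i, c i⟩⟩
    · rintro ⟨⟨d, e⟩, t, a, b⟩
      exact ⟨t, a, fun i => (b i).1, fun i => (b i).2, d, e⟩

theorem disjoint_columnsOn {n : ℕ} {p q : Fin n → Prop} [DecidablePred p] [DecidablePred q]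
    (i : Fin n) (hp : p i) (hq : ¬ q i) : Disjoint (columnsOn p) (columnsOn q) := by
  rw [Finset.disjoint_left]
  intro c hc hc'
  have h := (mem_columnsOn.1 hc i).1 hp
  exact (mem_columnsOn.1 hc' i).2 hq (h.1.trans h.2.symm)

theorem disjoint_columnsOn_mixedColumns {n : ℕ} {p : Fin n → Prop} [DecidablePred p]
    (i : Fin n) (hp : p i) : Disjoint (columnsOn p) (mixedColumns n) := by
  rw [Finset.disjoint_left]
  intro c hc hc'
  have h := (mem_columnsOn.1 hc i).1 hp
  exact (mem_mixedColumns.1 hc').1 i (h.1.trans h.2.symm)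

theorem sum_two_pow_fin (m : ℕ) : ∑ t : Fin m, 2 ^ (t : ℕ) = 2 ^ m - 1 := by
  rw [Fin.sum_univ_eq_sum_range (fun t => 2 ^ t) m, Nat.geomSum_eq le_rfl]
  simp

theorem card_columnsOn_ge {n : ℕ} (t : Fin n) : (columnsOn (t ≤ ·)).card = 2 ^ (t : ℕ) := by
  rw [card_columnsOn, ← Fin.card_Iio]
  congr 2
  ext i
  simp

theorem card_columnsOn_le {n : ℕ} (s : Fin n) :
    (columnsOn (· ≤ s)).card = 2 ^ (n - 1 - (s : ℕ)) := by
  rw [card_columnsOn, ← Fin.card_Ioi]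
  congr 2
  ext i
  simp

theorem card_biUnion_columnsOn_ge (n : ℕ) [NeZero n] :
    ((Finset.univ.filter (· < lastIdx n)).biUnion fun t => columnsOn (t ≤ ·)).card =
      2 ^ (n - 1) - 1 := by
  obtain ⟨m, rfl⟩ := Nat.exists_eq_succ_of_ne_zero (NeZero.ne n)
  rw [Finset.card_biUnion]
  · simp only [card_columnsOn_ge, Finset.sum_filter, Fin.sum_univ_castSucc, Nat.succ_eq_add_one]
    simp [lastIdx, Fin.lt_def, sum_two_pow_fin]
  · intro t _ t' _ h
    rcases lt_or_gt_of_ne h with h | h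
    · exact disjoint_columnsOn (p := (t ≤ ·)) (q := (t' ≤ ·)) t (le_refl t) (not_le.2 h)
    · exact (disjoint_columnsOn (p := (t' ≤ ·)) (q := (t ≤ ·)) t' (le_refl t') (not_le.2 h)).symm

theorem card_biUnion_columnsOn_le (n : ℕ) [NeZero n] :
    ((Finset.univ.filter ((0 : Fin n) < ·)).biUnion fun s => columnsOn (· ≤ s)).card =
      2 ^ (n - 1) - 1 := by
  obtain ⟨m, rfl⟩ := Nat.exists_eq_succ_of_ne_zero (NeZero.ne n)
  rw [Finset.card_biUnion]
  · simp only [card_columnsOn_le, Finset.sum_filter, Fin.sum_univ_succ, Nat.succ_eq_add_one]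
    -- Reversing the order turns the decreasing exponents into the standard geometric sum.
    rw [← Equiv.sum_comp Fin.revPerm]
    simp only [lt_self_iff_false, if_false, Fin.succ_pos, if_true, zero_add, Fin.val_succ,
      Fin.revPerm_apply, Fin.val_rev]
    rw [Nat.add_sub_cancel, ← sum_two_pow_fin m]
    refine Finset.sum_congr rfl fun i _ => ?_
    have := i.isLt
    congr 1
    omega
  · intro t _ t' _ h
    rcases lt_or_gt_of_ne h with h | h
    · exact (disjoint_columnsOn (p := (· ≤ t')) (q := (· ≤ t)) t' (le_refl t') (not_le.2 h)).symm
    · exact disjoint_columnsOn (p := (· ≤ t)) (q := (· ≤ t')) t (le_refl t) (not_le.2 h)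

theorem ncard_S (n : ℕ) [NeZero n] :
    ((S n).ncard : ℤ) = 5 * 4 ^ (n - 1) - 2 ^ (n + 2) + 4 := by
  have h1 : (columnsOn (lastIdx n ≤ ·)).card = 2 ^ (n - 1) := by
    rw [card_columnsOn_ge, lastIdx]
  have h2 : (columnsOn (· ≤ (0 : Fin n))).card = 2 ^ (n - 1) := by
    rw [card_columnsOn_le]
    simp
  rw [S_eq_preimage, Set.ncard_preimage_of_injective_subset_range (signatureEquiv n).injective
    (by simp [(signatureEquiv n).surjective.range_eq]), Set.ncard_coe_finset,
    Finset.card_union_of_disjoint, Finset.card_union_of_disjoint, Finset.card_product,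
    Finset.card_product, Finset.card_product, card_biUnion_columnsOn_ge,
    card_biUnion_columnsOn_le, card_mixedColumns, h1, h2]
  · obtain ⟨m, rfl⟩ := Nat.exists_eq_succ_of_ne_zero (NeZero.ne n)
    have e1 : 1 ≤ 2 ^ m := Nat.one_le_two_pow
    have e2 : 2 ≤ 2 ^ (m + 1) := by rw [pow_succ]; omega
    have e3 : (4 : ℤ) ^ m = 2 ^ m * 2 ^ m := by rw [← mul_pow]; norm_num
    simp only [Nat.succ_eq_add_one, Nat.add_sub_cancel]
    push_cast [Nat.cast_sub e1, Nat.cast_sub e2]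
    rw [e3]
    ring
  · rw [Finset.disjoint_product]
    exact Or.inr (disjoint_columnsOn_mixedColumns (p := (· ≤ (0 : Fin n))) 0 (le_refl 0)).symm
  · rw [Finset.disjoint_union_left, Finset.disjoint_product, Finset.disjoint_product]
    refine ⟨Or.inl ?_, Or.inl ?_⟩
    · rw [Finset.disjoint_biUnion_left]
      exact fun t _ => disjoint_columnsOn_mixedColumns (p := (t ≤ ·)) t (le_refl t)
    · exact disjoint_columnsOn_mixedColumns (p := (lastIdx n ≤ ·)) _ (le_refl (lastIdx n))

/-! ### Admissible signatures are the members of `S` -/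

theorem or_eq_true_of_ne {a b : Bool} (h : a ≠ b) : a = true ∨ b = true := by
  cases a <;> cases b <;> simp_all

theorem ne_of_or_of_not_and {a b : Bool} (h : a = true ∨ b = true)
    (h' : ¬ (a = true ∧ b = true)) : a ≠ b := by
  cases a <;> cases b <;> simp_all

theorem admissible_of_mem_S {n : ℕ} [NeZero n] {γ : Fin n → ℝ} (hγ : StrictMono γ)
    {B : Signature n} (hB : B ∈ S n) :
    Admissible (fun i => γ 0 + γ i) (fun j => -γ j - γ (lastIdx n)) B (-alpha γ B) := by
  have h0 : ∀ i, γ 0 ≤ γ i := fun i => hγ.monotone (Fin.zero_le i)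
  have hl : ∀ i, γ i ≤ γ (lastIdx n) := fun i => hγ.monotone (le_lastIdx i)
  rcases hB with (⟨t, ht⟩ | h2) | ⟨s, hs⟩
  · rw [alpha_of_isS1At γ ht]
    obtain ⟨t1, t2, t3, t4, i, j, hi, hj⟩ := ht
    refine ⟨⟨t, (t2 t le_rfl).1⟩, ⟨t, (t2 t le_rfl).2⟩, ⟨i, hi⟩, ⟨j, hj⟩, fun k => ?_,
      fun k => or_eq_true_of_ne (t4 k), fun k => ?_, fun k => ?_, Or.inl ⟨t, by ring⟩⟩
    · rcases le_or_gt t k with hk | hk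
      · exact Or.inl (t2 k hk).1
      · exact or_eq_true_of_ne (t3 k hk)
    · rcases le_or_gt t k with hk | hk
      · exact iff_of_true (t2 k hk) (by linarith [hγ.monotone hk])
      · exact iff_of_false (fun h => t3 k hk (h.1.trans h.2.symm)) (by linarith [hγ hk])
    · exact iff_of_false (fun h => t4 k (h.1.trans h.2.symm)) (by linarith [hγ t1, h0 k])
  · rw [alpha_of_mem_S2 γ h2]
    obtain ⟨⟨b1, b2, b3, b4⟩, c, d⟩ := h2
    have hc : ∀ k, k = lastIdx n ∨ k < lastIdx n := fun k => (le_lastIdx k).eq_or_lt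
    have hd : ∀ k : Fin n, 0 = k ∨ 0 < k := fun k => (Fin.zero_le k).eq_or_lt
    refine ⟨⟨_, b1⟩, ⟨_, b2⟩, ⟨_, b3⟩, ⟨_, b4⟩, fun k => ?_, fun k => ?_, fun k => ?_,
      fun k => ?_, Or.inl ⟨lastIdx n, by ring⟩⟩
    · rcases hc k with rfl | hk
      · exact Or.inl b1
      · exact or_eq_true_of_ne (c k hk)
    · rcases hd k with rfl | hk
      · exact Or.inl b3
      · exact or_eq_true_of_ne (d k hk)
    · rcases hc k with rfl | hk
      · exact iff_of_true ⟨b1, b2⟩ (by linarith)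
      · exact iff_of_false (fun h => c k hk (h.1.trans h.2.symm)) (by linarith [hγ hk])
    · rcases hd k with rfl | hk
      · exact iff_of_true ⟨b3, b4⟩ (by linarith)
      · exact iff_of_false (fun h => d k hk (h.1.trans h.2.symm)) (by linarith [hγ hk])
  · rw [alpha_of_isS3At γ hs]
    obtain ⟨s1, s2, s3, s4, i, j, hi, hj⟩ := hs
    refine ⟨⟨i, hi⟩, ⟨j, hj⟩, ⟨s, (s2 s le_rfl).1⟩, ⟨s, (s2 s le_rfl).2⟩,
      fun k => or_eq_true_of_ne (s4 k), fun k => ?_, fun k => ?_, fun k => ?_,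
      Or.inr ⟨s, by ring⟩⟩
    · rcases le_or_gt k s with hk | hk
      · exact Or.inl (s2 k hk).1
      · exact or_eq_true_of_ne (s3 k hk)
    · exact iff_of_false (fun h => s4 k (h.1.trans h.2.symm)) (by linarith [hγ s1, hl k])
    · rcases le_or_gt k s with hk | hk
      · exact iff_of_true (s2 k hk) (by linarith [hγ.monotone hk])
      · exact iff_of_false (fun h => s3 k hk (h.1.trans h.2.symm)) (by linarith [hγ hk])

/-- Strict monotonicity turns the sets `β ≤ f i` and `-β ≤ g j` into a final and an initial segment.
Both are nonempty only for `β = γ 0 + γ (lastIdx n)`, which is `S₂`; otherwise the threshold index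
is the `t` of `S₁` or the `s` of `S₃`. -/
theorem Admissible.mem_S {n : ℕ} [NeZero n] {γ : Fin n → ℝ} (hγ : StrictMono γ)
    {B : Signature n} {β : ℝ}
    (h : Admissible (fun i => γ 0 + γ i) (fun j => -γ j - γ (lastIdx n)) B β) :
    B ∈ S n ∧ alpha γ B = -β := by
  have h0 : ∀ i, γ 0 ≤ γ i := fun i => hγ.monotone (Fin.zero_le i)
  have hl : ∀ i, γ i ≤ γ (lastIdx n) := fun i => hγ.monotone (le_lastIdx i)
  have hf : ∀ i, γ 0 + γ i < β → B (i, 0, 0) ≠ B (i, 0, 1) := fun i hi =>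
    ne_of_or_of_not_and (h.or_f i) fun k => not_le.2 hi ((h.and_f i).1 k)
  have hg : ∀ j, -γ j - γ (lastIdx n) < -β → B (j, 1, 0) ≠ B (j, 1, 1) := fun j hj =>
    ne_of_or_of_not_and (h.or_g j) fun k => not_le.2 hj ((h.and_g j).1 k)
  obtain ⟨iA, hiA⟩ := h.ex_a
  obtain ⟨iB, hiB⟩ := h.ex_b
  obtain ⟨jP, hjP⟩ := h.ex_p
  obtain ⟨jQ, hjQ⟩ := h.ex_q
  by_cases hS2 : β = γ 0 + γ (lastIdx n)
  · have h2 : B ∈ S2 n := by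
      have e1 := (h.and_f (lastIdx n)).2 (by linarith)
      have e2 := (h.and_g 0).2 (by linarith)
      exact ⟨⟨e1.1, e1.2, e2.1, e2.2⟩, fun i hi => hf i (by linarith [hγ hi]),
        fun j hj => hg j (by linarith [hγ hj])⟩
    exact ⟨Or.inl (Or.inr h2), by rw [alpha_of_mem_S2 γ h2]; linarith⟩
  rcases h.threshold with ⟨t, ht⟩ | ⟨s, hs⟩
  · have htl : t < lastIdx n := lt_of_le_of_ne (le_lastIdx t) fun e => hS2 (by rw [← ht, e])
    have h1 : IsS1At t B := by
      refine ⟨htl, fun i hi => (h.and_f i).2 ?_, fun i hi => hf i ?_, fun i => hg i ?_,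
        jP, jQ, hjP, hjQ⟩
      · linarith [hγ.monotone hi]
      · linarith [hγ hi]
      · linarith [hγ htl, h0 i]
    exact ⟨Or.inl (Or.inl ⟨t, h1⟩), by rw [alpha_of_isS1At γ h1]; linarith⟩
  · have hs0 : 0 < s := lt_of_le_of_ne (Fin.zero_le s) fun e => hS2 (by rw [e]; linarith)
    have h3 : IsS3At s B := by
      refine ⟨hs0, fun i hi => (h.and_g i).2 ?_, fun i hi => hg i ?_, fun i => hf i ?_,
        iA, iB, hiA, hiB⟩
      · linarith [hγ.monotone hi]
      · linarith [hγ hi]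
      · linarith [hγ hs0, hl i]
    exact ⟨Or.inr ⟨s, h3⟩, by rw [alpha_of_isS3At γ h3]; linarith⟩

/-! ### The vertex map and its inverse -/

theorem isVertex_u {n : ℕ} [NeZero n] {γ : Fin n → ℝ} (hγ : StrictMono γ)
    {B : Signature n} (hB : B ∈ S n) : IsVertex γ (u γ B) := by
  rw [isVertex_iff_isRigid hγ]
  convert (admissible_of_mem_S hγ hB).isRigid using 2 with i i i i <;>
    simp only [u] <;> split_ifs <;> ring

open Classical in
/-- The signature of a point: an entry is `true` if it is maximal, after the shift by `γ`, among
the entries with the same treatment and instrument. -/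
noncomputable def peakSignature {n : ℕ} (γ : Fin n → ℝ) (v : Col n 2 → ℝ) : Signature n
  | (i, 0, 0) => decide (∀ k, v (k, 0, 0) + γ k ≤ v (i, 0, 0) + γ i)
  | (i, 0, 1) => decide (∀ k, v (k, 0, 1) + γ k ≤ v (i, 0, 1) + γ i)
  | (i, 1, 0) => decide (∀ k, v (k, 1, 0) - γ k ≤ v (i, 1, 0) - γ i)
  | (i, 1, 1) => decide (∀ k, v (k, 1, 1) - γ k ≤ v (i, 1, 1) - γ i)

/-- Only differences of entries with equal `d` and `z` are compared, and such a difference is the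
difference of two mixed rows sharing their other entry. -/
theorem peakSignature_congr {n : ℕ} {γ : Fin n → ℝ} {v w : Col n 2 → ℝ} (h : MEquiv v w) :
    peakSignature γ v = peakSignature γ w := by
  obtain ⟨-, -, h3, h4⟩ := mEquiv_iff.1 h
  ext ⟨i, d, z⟩
  fin_cases d <;> fin_cases z <;> dsimp only [peakSignature] <;>
    congr 1 <;> refine propext (forall_congr' fun k => ?_)
  · constructor <;> intro <;> linarith [h3 i i, h3 k i]
  · constructor <;> intro <;> linarith [h4 i i, h4 k i]
  · constructor <;> intro <;> linarith [h4 i i, h4 i k]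
  · constructor <;> intro <;> linarith [h3 i i, h3 i k]

/-- Maximality among the values of `x`, when these are bounded by the attained value `m`. -/
theorem forall_le_iff_eq {ι : Type*} {x : ι → ℝ} {m : ℝ} (hle : ∀ k, x k ≤ m)
    (hex : ∃ k, x k = m) (i : ι) : (∀ k, x k ≤ x i) ↔ x i = m := by
  constructor
  · intro h
    obtain ⟨k, hk⟩ := hex
    exact le_antisymm (hle i) (hk ▸ h k)
  · intro h k
    rw [h]
    exact hle k

/-- After the shift, marked entries of `u γ B` take the values `-α, 0, 0, α`. Unmarked ones are
strictly smaller, because a row that is not `(1, 1)` misses the threshold strictly. -/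
theorem peakSignature_u {n : ℕ} [NeZero n] {γ : Fin n → ℝ} (hγ : StrictMono γ)
    {B : Signature n} (hB : B ∈ S n) : peakSignature γ (u γ B) = B := by
  have h := admissible_of_mem_S hγ hB
  have hf : ∀ i, ¬ (B (i, 0, 0) = true ∧ B (i, 0, 1) = true) → γ 0 + γ i < -alpha γ B :=
    fun i hi => not_le.1 fun hle => hi ((h.and_f i).2 hle)
  have hg : ∀ j, ¬ (B (j, 1, 0) = true ∧ B (j, 1, 1) = true) →
      -γ j - γ (lastIdx n) < alpha γ B :=
    fun j hj => not_le.1 fun hle => hj ((h.and_g j).2 (by linarith))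
  have key : ∀ {x : Fin n → ℝ} {b : Fin n → Bool} {m : ℝ}, (∃ i, b i = true) →
      (∀ i, b i = true → x i = m) → (∀ i, b i ≠ true → x i < m) →
      ∀ i, (∀ k, x k ≤ x i) ↔ b i = true := by
    rintro x b m ⟨i₀, hi₀⟩ ht hn i
    rw [forall_le_iff_eq (m := m) (fun k => ?_) ⟨i₀, ht i₀ hi₀⟩]
    · exact ⟨fun h => by_contra fun hb => (hn i hb).ne h, ht i⟩
    · by_cases hb : b k = true
      · exact (ht k hb).le
      · exact (hn k hb).le
  ext ⟨i, d, z⟩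
  rw [Bool.eq_iff_iff]
  fin_cases d <;> fin_cases z <;>
    simp only [Fin.zero_eta, Fin.mk_one, peakSignature, decide_eq_true_eq]
  · refine key (x := fun k => u γ B (k, 0, 0) + γ k) (b := fun k => B (k, 0, 0))
      (m := -alpha γ B) h.ex_a (fun k hk => ?_) (fun k hk => ?_) i <;> simp only [u, hk]
    · simp only [if_true]
      ring
    · simpa using hf k fun h => hk h.1
  · refine key (x := fun k => u γ B (k, 0, 1) + γ k) (b := fun k => B (k, 0, 1))
      (m := 0) h.ex_b (fun k hk => ?_) (fun k hk => ?_) i <;> simp only [u, hk]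
    · simp
    · simp only [Bool.false_eq_true, if_false]
      linarith [hf k fun h => hk h.2]
  · refine key (x := fun k => u γ B (k, 1, 0) - γ k) (b := fun k => B (k, 1, 0))
      (m := 0) h.ex_p (fun k hk => ?_) (fun k hk => ?_) i <;> simp only [u, hk]
    · simp
    · simp only [Bool.false_eq_true, if_false]
      linarith [hg k fun h => hk h.1]
  · refine key (x := fun k => u γ B (k, 1, 1) - γ k) (b := fun k => B (k, 1, 1))
      (m := alpha γ B) h.ex_q (fun k hk => ?_) (fun k hk => ?_) i <;> simp only [u, hk]
    · simp
    · simp only [Bool.false_eq_true, if_false]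
      linarith [hg k fun h => hk h.2]

theorem IsVertex.mEquiv_u_peakSignature {n : ℕ} [NeZero n] {γ : Fin n → ℝ} (hγ : StrictMono γ)
    {v : Col n 2 → ℝ} (hv : IsVertex γ v) :
    peakSignature γ v ∈ S n ∧ MEquiv v (u γ (peakSignature γ v)) := by
  have hr := (isVertex_iff_isRigid hγ).1 hv
  -- The hypothesis holds with equality: `f (lastIdx n) + g 0 = 0`.
  obtain ⟨x, y, hp⟩ := hr.exists_hasPeaks ⟨lastIdx n, 0, by ring_nf; exact le_rfl⟩
  have sa : ∀ i, peakSignature γ v (i, 0, 0) = true ↔ v (i, 0, 0) + γ i = x := fun i => by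
    simpa only [peakSignature, decide_eq_true_eq] using forall_le_iff_eq hp.le_a hp.ex_a i
  have sb : ∀ i, peakSignature γ v (i, 0, 1) = true ↔ v (i, 0, 1) + γ i = y := fun i => by
    simpa only [peakSignature, decide_eq_true_eq] using forall_le_iff_eq hp.le_b hp.ex_b i
  have sp : ∀ i, peakSignature γ v (i, 1, 0) = true ↔ v (i, 1, 0) - γ i = -y := fun i => by
    simpa only [peakSignature, decide_eq_true_eq] using forall_le_iff_eq hp.le_p hp.ex_p i
  have sq : ∀ i, peakSignature γ v (i, 1, 1) = true ↔ v (i, 1, 1) - γ i = -x := fun i => by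
    simpa only [peakSignature, decide_eq_true_eq] using forall_le_iff_eq hp.le_q hp.ex_q i
  have had : Admissible (fun i => γ 0 + γ i) (fun j => -γ j - γ (lastIdx n))
      (peakSignature γ v) (x + y) := by
    constructor
    · simpa only [sa] using hp.ex_a
    · simpa only [sb] using hp.ex_b
    · simpa only [sp] using hp.ex_p
    · simpa only [sq] using hp.ex_q
    · intro i
      rw [sa, sb]
      exact (hp.tied_a i).imp_right And.left
    · intro i
      rw [sp, sq]
      exact (hp.tied_p i).imp_right And.left
    · intro i
      rw [sa, sb]
      refine ⟨fun h => by linarith [hr.ab i], fun h => ⟨?_, ?_⟩⟩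
      · refine (hp.tied_a i).elim id fun k => ?_
        linarith [hp.le_a i]
      · refine (hp.tied_b i).elim id fun k => ?_
        linarith [hp.le_b i]
    · intro i
      rw [sp, sq]
      refine ⟨fun h => by linarith [hr.pq i], fun h => ⟨?_, ?_⟩⟩
      · refine (hp.tied_p i).elim id fun k => ?_
        linarith [hp.le_p i]
      · refine (hp.tied_q i).elim id fun k => ?_
        linarith [hp.le_q i]
    · exact hp.threshold.imp (fun ⟨i, _, _, h⟩ => ⟨i, h⟩) (fun ⟨j, _, _, h⟩ => ⟨j, h⟩)
  obtain ⟨hS, hα⟩ := had.mem_S hγ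
  -- `u` differs from `v` by `y` times the kernel vector, `+1` at `z = 0` and `-1` at `z = 1`, which
  -- moves the maximum of `B` to `0`.
  have ea : ∀ i, u γ (peakSignature γ v) (i, 0, 0) = v (i, 0, 0) + y := fun i => by
    simp only [u, hα]
    split_ifs with h
    · linarith [(sa i).1 h]
    · linarith [(hp.tied_a i).resolve_left fun k => h ((sa i).2 k)]
  have eb : ∀ i, u γ (peakSignature γ v) (i, 0, 1) = v (i, 0, 1) - y := fun i => by
    simp only [u, hα]
    split_ifs with h
    · linarith [(sb i).1 h]
    · linarith [(hp.tied_b i).resolve_left fun k => h ((sb i).2 k)]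
  have ep : ∀ i, u γ (peakSignature γ v) (i, 1, 0) = v (i, 1, 0) + y := fun i => by
    simp only [u, hα]
    split_ifs with h
    · linarith [(sp i).1 h]
    · linarith [(hp.tied_p i).resolve_left fun k => h ((sp i).2 k)]
  have eq : ∀ i, u γ (peakSignature γ v) (i, 1, 1) = v (i, 1, 1) - y := fun i => by
    simp only [u, hα]
    split_ifs with h
    · linarith [(sq i).1 h]
    · linarith [(hp.tied_q i).resolve_left fun k => h ((sq i).2 k)]
  refine ⟨hS, mEquiv_iff.2 ⟨fun i => ?_, fun i => ?_, fun i j => ?_, fun i j => ?_⟩⟩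
  · rw [ea, eb]; ring
  · rw [ep, eq]; ring
  · rw [ea, eq]; ring
  · rw [ep, eb]; ring

theorem eq_of_mEquiv_u {n : ℕ} [NeZero n] {γ : Fin n → ℝ} (hγ : StrictMono γ)
    {B B' : Signature n} (hB : B ∈ S n) (hB' : B' ∈ S n) (h : MEquiv (u γ B) (u γ B')) :
    B = B' := by
  rw [← peakSignature_u hγ hB, ← peakSignature_u hγ hB', peakSignature_congr h]

end BinaryIV

theorem mainTheorem1 (n : ℕ) [NeZero n] (γ : Fin n → ℝ) (hγ : StrictMono γ) :
    -- `V = u(S)` is a set of pairwise `M`-distinct vertices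
    (∀ v ∈ BinaryIV.u γ '' BinaryIV.S n, BinaryIV.IsVertex γ v) ∧
    (BinaryIV.u γ '' BinaryIV.S n).Pairwise (fun v w => ¬ BinaryIV.MEquiv v w) ∧
    -- every vertex is `M`-equivalent to a member of `V`
    (∀ v : BinaryIV.Col n 2 → ℝ, BinaryIV.IsVertex γ v →
      ∃ w ∈ BinaryIV.u γ '' BinaryIV.S n, BinaryIV.MEquiv v w) ∧
    -- `B ↦ [u(B)]` is a bijection from `S` onto the vertex classes
    (∃ h : ∀ B : BinaryIV.S n, BinaryIV.IsVertex γ (BinaryIV.u γ B.1),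
      Function.Bijective (fun B : BinaryIV.S n =>
        (Quotient.mk (BinaryIV.vertexSetoid 2 γ) ⟨BinaryIV.u γ B.1, h B⟩ :
          BinaryIV.VertexClass 2 γ))) ∧
    -- the number of vertex classes and of admissible signatures
    (Nat.card (BinaryIV.VertexClass 2 γ) : ℤ) = 5 * 4 ^ (n - 1) - 2 ^ (n + 2) + 4 ∧
    ((BinaryIV.S n).ncard : ℤ) = 5 * 4 ^ (n - 1) - 2 ^ (n + 2) + 4 := by
  have hbij : Function.Bijective (fun B : BinaryIV.S n =>
      (Quotient.mk (BinaryIV.vertexSetoid 2 γ) ⟨BinaryIV.u γ B.1, BinaryIV.isVertex_u hγ B.2⟩ :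
        BinaryIV.VertexClass 2 γ)) := by
    constructor
    · intro B B' h
      exact Subtype.ext (BinaryIV.eq_of_mEquiv_u hγ B.2 B'.2 (Quotient.exact h))
    · intro c
      induction c using Quotient.inductionOn with
      | h v =>
        obtain ⟨hS, he⟩ := v.2.mEquiv_u_peakSignature hγ
        exact ⟨⟨_, hS⟩, Quotient.sound (Eq.symm he)⟩
  refine ⟨?_, ?_, ?_, ⟨fun B => BinaryIV.isVertex_u hγ B.2, hbij⟩, ?_, BinaryIV.ncard_S n⟩
  · rintro _ ⟨B, hB, rfl⟩
    exact BinaryIV.isVertex_u hγ hB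
  · rintro _ ⟨B, hB, rfl⟩ _ ⟨B', hB', rfl⟩ hne h
    exact hne (congrArg _ (BinaryIV.eq_of_mEquiv_u hγ hB hB' h))
  · intro v hv
    obtain ⟨hS, he⟩ := hv.mEquiv_u_peakSignature hγ
    exact ⟨_, ⟨_, hS, rfl⟩, he⟩
  · rw [← Nat.card_eq_of_bijective _ hbij, Nat.card_coe_set_eq]
    exact BinaryIV.ncard_S n
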